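/- Let $f(\mathbf z,\bar{\mathbf z})$ and $g(\mathbf z,\bar{\mathbf z})$ be mixed polynomials in two complex variables $\mathbf z=(z_1,z_2)$, that is, complex polynomials in $z_1,z_2,\bar z_1,\bar z_2$. Identify $\mathbb C^2$ with $\mathbb R^4$ by $(z_1,z_2)\leftrightarrow(x_1,y_1,x_2,y_2)$, $z_j=x_j+iy_j$, and write $f=f_{\mathbb R}+if_I$, $g=g_{\mathbb R}+ig_I$ with real polynomial functions $f_{\mathbb R},f_I,g_{\mathbb R},g_I$ on $\mathbb R^4$. Let $C=\{f=0\}$, $C'=\{g=0\}$ and $P\in C\cap C'$. Assume that $C$ and $C'$ are mixed non-singular at $P$ (the real Jacobian matrices of $(f_{\mathbb R},f_I)$ and of $(g_{\mathbb R},g_I)$ have rank $2$ at $P$) and intersect transversely at $P$ ($T_PC+T_PC'=\mathbb R^4$, where $T_PC=\ker df_P$ and $T_PC'=\ker dg_P$). Topological intersection number. Orient $T_PC$ by calling a frame $(\mathbf u_1,\mathbf u_2)$ of it positive if $\det(\mathbf u_1,\mathbf u_2,\operatorname{grad}f_{\mathbb R}(P),\operatorname{grad}f_I(P))>0$, and orient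 $T_PC'$ in the same way using $g$. The topological intersection number of $C$ and $C'$ at $P$ is the sign, $1$ or $-1$, of $\det(\mathbf u_1,\mathbf u_2,\mathbf v_1,\mathbf v_2)$, where $(\mathbf u_1,\mathbf u_2)$ and $(\mathbf v_1,\mathbf v_2)$ are positive frames of $T_PC$ and $T_PC'$; it does not depend on the frames. Local intersection number. Put $\varphi=(f_{\mathbb R},f_I,g_{\mathbb R},g_I):\mathbb R^4\to\mathbb R^4$. When $P$ is an isolated point of $C\cap C'$ at which each of $C$, $C'$ has at worst an isolated mixed singularity, the local intersection number of $C$ and $C'$ at $P$ is the mapping degree of $$\psi=\varphi/\|\varphi\|:\ S^3_\varepsilon(P)=\{\mathbf x\in\mathbb R^4:\|\mathbf x-P\|=\varepsilon\}\longrightarrow S^3$$ for all sufficiently small $\varepsilon>0$, for which in particular $P$ is the only point of $C\cap C'$ in the closed ball of radius $\varepsilon$ about $P$. Both spheres carry the orientation as boundary of a ball of $\mathbb R^4$, and the mapping degree of a smooth map between them is the number of preimages of a regular value, counted with sign $+1$ or $-1$ according as the differential preserves or reverses the orientation. Proposition. Under the assumptions above, the topological intersection number and the local intersection number of $C$ and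 $C'$ at $P$ are both defined, and they are equal. -/

import Mathlib

namespace MixedCurve

noncomputable section

/-- `ℝ⁴` with its Euclidean norm. It is identified with `ℂ²` through
`(z₁, z₂) ↔ (x₁, y₁, x₂, y₂)`, where `zⱼ = xⱼ + i yⱼ`. -/
abbrev R4 : Type := EuclideanSpace ℝ (Fin 4)

/-- The point `(z₁, z₂)` of `ℂ²` with real coordinates `(x₁, y₁, x₂, y₂)`. -/
def toC2 (p : R4) : Fin 2 → ℂ := ![⟨p 0, p 1⟩, ⟨p 2, p 3⟩]

/-- Mixed polynomials `f(z, z̄)` of two complex variables: `Sum.inl j` is the variable `zⱼ` and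
`Sum.inr j` is the variable `z̄ⱼ`. -/
abbrev MixedPolynomial : Type := MvPolynomial (Fin 2 ⊕ Fin 2) ℂ

/-- The complex valued function `z ↦ f(z, z̄)`. -/
def value (f : MixedPolynomial) (p : R4) : ℂ :=
  MvPolynomial.eval (Sum.elim (toC2 p) fun j => (starRingEnd ℂ) (toC2 p j)) f

/-- The real part of `f`, as a function of `(x₁, y₁, x₂, y₂)`. -/
def rePart (f : MixedPolynomial) (p : R4) : ℝ := (value f p).re

/-- The imaginary part of `f`, as a function of `(x₁, y₁, x₂, y₂)`. -/
def imPart (f : MixedPolynomial) (p : R4) : ℝ := (value f p).im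

/-- The mixed curve `C : f(z, z̄) = 0`. -/
def curve (f : MixedPolynomial) : Set R4 := {p | value f p = 0}

/-- The `2 × 4` real Jacobian matrix of `f` at `p`; its rows are the gradients of the real part
and of the imaginary part. -/
def jacobian (f : MixedPolynomial) (p : R4) : Matrix (Fin 2) (Fin 4) ℝ :=
  Matrix.of ![⇑(gradient (rePart f) p), ⇑(gradient (imPart f) p)]

/-- `p` is a mixed non-singular point of the curve `f = 0`. -/
def IsMixedNonsingular (f : MixedPolynomial) (p : R4) : Prop :=
  p ∈ curve f ∧ (jacobian f p).rank = 2

/-- The curve `f = 0` has at worst an isolated mixed singularity at `p`. -/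
def HasAtWorstIsolatedSingularity (f : MixedPolynomial) (p : R4) : Prop :=
  ∀ᶠ q in nhdsWithin p {p}ᶜ, q ∈ curve f → IsMixedNonsingular f q

/-! ### The topological intersection number of a transverse intersection -/

/-- The determinant of four vectors of `ℝ⁴`; `(w₁, w₂, w₃, w₄)` is a positive frame when this is
positive. -/
def frameDet (w₁ w₂ w₃ w₄ : R4) : ℝ := (Matrix.of ![⇑w₁, ⇑w₂, ⇑w₃, ⇑w₄]).det

/-- The tangent space at `p` of the curve `f = 0`, for a mixed non-singular point `p`: the kernel
of the real differential of `f`. -/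
def tangentSpace (f : MixedPolynomial) (p : R4) : Submodule ℝ R4 :=
  LinearMap.ker (fderiv ℝ (value f) p : R4 →ₗ[ℝ] ℂ)

/-- `(v₁, v₂)` is a positive frame of the tangent space at `p` of the oriented curve `f = 0`. -/
def IsPositiveFrame (f : MixedPolynomial) (p v₁ v₂ : R4) : Prop :=
  v₁ ∈ tangentSpace f p ∧ v₂ ∈ tangentSpace f p ∧
    0 < frameDet v₁ v₂ (gradient (rePart f) p) (gradient (imPart f) p)

/-- The curves `f = 0` and `g = 0` intersect transversely at `p`. -/
def IsTransverse (f g : MixedPolynomial) (p : R4) : Prop :=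
  tangentSpace f p ⊔ tangentSpace g p = ⊤

/-- `d` is the topological intersection number at `p` of `f = 0` and `g = 0`: for positive frames
`(u₁, u₂)` and `(v₁, v₂)` of the two tangent spaces, `d` is the sign of `det (u₁, u₂, v₁, v₂)`,
and this does not depend on the frames. -/
def IsTopologicalIntersectionNumber (f g : MixedPolynomial) (p : R4) (d : ℤ) : Prop :=
  (∃ u₁ u₂, IsPositiveFrame f p u₁ u₂) ∧ (∃ v₁ v₂, IsPositiveFrame g p v₁ v₂) ∧
    ∀ u₁ u₂ v₁ v₂, IsPositiveFrame f p u₁ u₂ → IsPositiveFrame g p v₁ v₂ →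
      (0 < frameDet u₁ u₂ v₁ v₂ ∧ d = 1) ∨ (frameDet u₁ u₂ v₁ v₂ < 0 ∧ d = -1)

/-! ### The mapping degree of a smooth map between 3-spheres -/

/-- For `ψ` on the sphere of radius `ε` around `p`, the extension of `ψ` that is positively
homogeneous of degree one about `p`:
`x ↦ (‖x - p‖ / ε) ψ(p + ε (x - p) / ‖x - p‖)`. -/
def coneExtension (p : R4) (ε : ℝ) (ψ : R4 → R4) (x : R4) : R4 :=
  (‖x - p‖ / ε) • ψ (p + (ε / ‖x - p‖) • (x - p))

/-- The Jacobian determinant at a point `x` of the sphere of radius `ε` around `p` of a map `ψ`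
from that sphere to the unit sphere. The differential at `x` of the cone extension restricts on
the tangent space of the sphere to the differential of `ψ`, and sends the outward vector `x - p`
to the outward vector `ψ x` of the unit sphere. Hence its determinant vanishes iff the
differential of `ψ` at `x` is singular, and otherwise it is positive or negative according as that
differential preserves or reverses the orientations of the spheres as boundaries of balls. -/
def sphereJacobian (p : R4) (ε : ℝ) (ψ : R4 → R4) (x : R4) : ℝ :=
  (fderiv ℝ (coneExtension p ε ψ) x).det

/-- The point `y` of the unit sphere is a regular value of `ψ` on the sphere of radius `ε`
around `p`. -/
def IsRegularValue (p : R4) (ε : ℝ) (ψ : R4 → R4) (y : R4) : Prop :=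
  y ∈ Metric.sphere (0 : R4) 1 ∧
    ∀ x ∈ Metric.sphere p ε, ψ x = y → sphereJacobian p ε ψ x ≠ 0

/-- `ψ` restricts to a smooth map from the sphere of radius `ε` around `p` to the unit sphere, and
`d` is its mapping degree: the number of preimages, counted with the sign of the Jacobian
determinant, of any regular value. Only the values of `ψ` on the sphere matter. -/
structure HasMappingDegree (p : R4) (ε : ℝ) (ψ : R4 → R4) (d : ℤ) : Prop where
  mapsTo : Set.MapsTo ψ (Metric.sphere p ε) (Metric.sphere 0 1)
  smooth : ContDiffOn ℝ (⊤ : ℕ∞) (coneExtension p ε ψ) {p}ᶜ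
  exists_regularValue : ∃ y, IsRegularValue p ε ψ y
  finite_preimage : ∀ y, IsRegularValue p ε ψ y → {x ∈ Metric.sphere p ε | ψ x = y}.Finite
  sum_sign : ∀ y, IsRegularValue p ε ψ y →
    ∑ᶠ x ∈ {x ∈ Metric.sphere p ε | ψ x = y}, (SignType.sign (sphereJacobian p ε ψ x) : ℤ) = d

theorem HasMappingDegree.unique {p : R4} {ε : ℝ} {ψ : R4 → R4} {d e : ℤ}
    (hd : HasMappingDegree p ε ψ d) (he : HasMappingDegree p ε ψ e) : d = e := by
  obtain ⟨y, hy⟩ := hd.exists_regularValue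
  exact (hd.sum_sign y hy).symm.trans (he.sum_sign y hy)

/-! ### The local intersection number -/

/-- The map `φ = (f_ℝ, f_I, g_ℝ, g_I) : ℝ⁴ → ℝ⁴`. -/
def realMap (f g : MixedPolynomial) (x : R4) : R4 :=
  !₂[rePart f x, imPart f x, rePart g x, imPart g x]

/-- The normalized map `ψ = φ / ‖φ‖`. -/
def normalizedMap (f g : MixedPolynomial) (x : R4) : R4 :=
  ‖realMap f g x‖⁻¹ • realMap f g x

/-- `d` is the local intersection number at `p` of `f = 0` and `g = 0`: the curves have at worst an
isolated mixed singularity at `p`, and for all sufficiently small `ε > 0` the point `p` is the only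
intersection point in the closed ball of radius `ε` around `p`, and the normalized map from the
sphere of radius `ε` around `p` to the unit sphere has mapping degree `d`. -/
def IsLocalIntersectionNumber (f g : MixedPolynomial) (p : R4) (d : ℤ) : Prop :=
  HasAtWorstIsolatedSingularity f p ∧ HasAtWorstIsolatedSingularity g p ∧
    ∀ᶠ ε in nhdsWithin (0 : ℝ) (Set.Ioi 0),
      curve f ∩ curve g ∩ Metric.closedBall p ε = {p} ∧
        HasMappingDegree p ε (normalizedMap f g) d

theorem IsTopologicalIntersectionNumber.unique {f g : MixedPolynomial} {p : R4} {d e : ℤ}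
    (hd : IsTopologicalIntersectionNumber f g p d)
    (he : IsTopologicalIntersectionNumber f g p e) : d = e := by
  obtain ⟨⟨u₁, u₂, hu⟩, ⟨v₁, v₂, hv⟩, h⟩ := hd
  rcases h u₁ u₂ v₁ v₂ hu hv with ⟨h1, h2⟩ | ⟨h1, h2⟩ <;>
    rcases he.2.2 u₁ u₂ v₁ v₂ hu hv with ⟨h3, h4⟩ | ⟨h3, h4⟩ <;>
    first | exact h2.trans h4.symm | exact absurd h1 (not_lt.mpr h3.le)

theorem IsLocalIntersectionNumber.unique {f g : MixedPolynomial} {p : R4} {d e : ℤ}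
    (hd : IsLocalIntersectionNumber f g p d) (he : IsLocalIntersectionNumber f g p e) :
    d = e := by
  obtain ⟨ε, h1, h2⟩ := (hd.2.2.and he.2.2).exists
  exact h1.2.unique h2.2

end

end MixedCurve

open Filter Topology

/-! Both numbers equal the sign of D = det Dφ(P), the determinant whose rows are the four gradients
at P. Transversality makes D nonzero: in a linear relation among the gradients, the f-part is minus
the g-part, so it is orthogonal to both tangent spaces and hence zero; the two rank conditions then
kill the coefficients.

Topological side: multiply determinants of frames by D. By orthogonality the products are block
determinants with a zero block, so det(u, v) * D factors into two 2×2 minors. The positive-frame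
conditions and nonnegative Gram determinants give each minor the sign of D
(`frameDet_mul_frameDet_pos`).

Degree side: put h = A⁻¹ ∘ φ with A = Dφ(P), so that h has strict derivative the identity at P. On
small spheres h is so close to x ↦ x - P that every open ray from 0 is hit exactly once
(`eventually_existsUnique_sphere_ray`). Hence ψ has one preimage over each unit vector. The Jacobian
of ψ there is det Dφ(x) times a positive factor (`det_fderiv_coneExtension`), so its sign is that of
D, and the degree is this sign. -/

namespace MixedCurve

/-! ### Maps close to the identity, and rays from the origin -/

section NearIdentity

variable {E : Type*} [NormedAddCommGroup E] [InnerProductSpace ℝ E]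

/-- Relative to `t • w` and `s • w` the errors are at most 1/3, so the inner product is at least (1
- 1/3 - 1/3 - 1/9) ‖t • w‖ ‖s • w‖. -/
theorem inner_nonneg_of_near_ray {a b w : E} {s t : ℝ} (hs : 0 ≤ s) (ht : 0 ≤ t)
    (ha : ‖t • w - a‖ ≤ ‖a‖ / 4) (hb : ‖s • w - b‖ ≤ ‖b‖ / 4) : 0 ≤ inner ℝ a b := by
  have ha' : ‖a‖ ≤ ‖t • w‖ + ‖t • w - a‖ := by
    simpa using norm_sub_le (t • w) (t • w - a)
  have hb' : ‖b‖ ≤ ‖s • w‖ + ‖s • w - b‖ := by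
    simpa using norm_sub_le (s • w) (s • w - b)
  have h1 : inner ℝ (t • w) (s • w) = ‖t • w‖ * ‖s • w‖ := by
    rw [real_inner_smul_left, real_inner_smul_right, real_inner_self_eq_norm_sq, norm_smul,
      norm_smul, Real.norm_of_nonneg hs, Real.norm_of_nonneg ht]
    ring
  have h2 := real_inner_le_norm (t • w) (s • w - b)
  have h3 := real_inner_le_norm (t • w - a) (s • w)
  have h4 := neg_le_of_abs_le (abs_real_inner_le_norm (t • w - a) (s • w - b))
  have h5 : inner ℝ a b = inner ℝ (t • w) (s • w) - inner ℝ (t • w) (s • w - b)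
      - inner ℝ (t • w - a) (s • w) + inner ℝ (t • w - a) (s • w - b) := by
    simp only [inner_sub_left, inner_sub_right]
    ring
  have hA : ‖t • w - a‖ ≤ ‖t • w‖ / 3 := by linarith
  have hB : ‖s • w - b‖ ≤ ‖s • w‖ / 3 := by linarith
  have h6 : ‖t • w‖ * ‖s • w - b‖ ≤ ‖t • w‖ * (‖s • w‖ / 3) := by gcongr
  have h7 : ‖t • w - a‖ * ‖s • w‖ ≤ ‖t • w‖ / 3 * ‖s • w‖ := by gcongr
  have h8 : ‖t • w - a‖ * ‖s • w - b‖ ≤ ‖t • w‖ / 3 * (‖s • w‖ / 3) := by gcongr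
  have h9 : 0 ≤ ‖t • w‖ * ‖s • w‖ := by positivity
  linarith

/-- The two estimates combine to ‖z - a‖ ≤ (2/3) ‖a‖, which keeps `z` in the open half-space around
`a`. -/
theorem inner_pos_of_near {a y z : E} (ha : a ≠ 0) (hy : ‖y - a‖ ≤ ‖a‖ / 4)
    (hz : ‖y - z‖ ≤ ‖z‖ / 4) : 0 < inner ℝ a z := by
  have hpos : 0 < ‖a‖ := norm_pos_iff.2 ha
  have h1 : ‖z - a‖ ≤ ‖y - z‖ + ‖y - a‖ := by
    rw [norm_sub_rev y z]
    simpa using norm_add_le (z - y) (y - a)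
  have h2 : ‖z‖ ≤ ‖a‖ + ‖z - a‖ := by simpa using norm_add_le a (z - a)
  have h3 : ‖z - a‖ < ‖a‖ := by linarith
  have h4 := neg_le_of_abs_le (abs_real_inner_le_norm a (z - a))
  have h5 : inner ℝ a z = ‖a‖ ^ 2 + inner ℝ a (z - a) := by
    rw [inner_sub_right, real_inner_self_eq_norm_sq]
    ring
  nlinarith

/-- A map whose strict derivative at `P` is the identity is nearly isometric near `P`. -/
theorem exists_ball_near_id {h : E → E} {P : E}
    (hd : HasStrictFDerivAt h (ContinuousLinearMap.id ℝ E) P) :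
    ∃ δ > 0, ∀ x ∈ Metric.ball P δ, ∀ x' ∈ Metric.ball P δ,
      ‖h x - h x' - (x - x')‖ ≤ ‖x - x'‖ / 4 := by
  have h1 := hd.isLittleO.def (c := 1 / 4) (by norm_num)
  obtain ⟨δ, hδ, h2⟩ := Metric.eventually_nhds_iff.1 h1
  refine ⟨δ, hδ, fun x hx x' hx' => ?_⟩
  have := h2 (y := (x, x')) (max_lt hx hx')
  simp only [ContinuousLinearMap.coe_id', id_eq] at this
  linarith

/-- Existence follows from the local inverse and the intermediate value theorem along the ray;
uniqueness holds because moving outward along the ray in the target strictly increases the distance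
to `P`. Rays, unlike unit vectors, are preserved by linear isomorphisms, so the result passes from
A⁻¹ ∘ φ to φ. -/
theorem eventually_existsUnique_sphere_ray [CompleteSpace E] {h : E → E} {P : E} (hP : h P = 0)
    (hd : HasStrictFDerivAt h (ContinuousLinearMap.id ℝ E) P) :
    ∀ᶠ ε in 𝓝[>] (0 : ℝ), ∀ w : E, w ≠ 0 →
      ∃! x, x ∈ Metric.sphere P ε ∧ ∃ t : ℝ, 0 < t ∧ h x = t • w := by
  obtain ⟨δ, hδ, hnear⟩ := exists_ball_near_id hd
  have hd' : HasStrictFDerivAt h ((ContinuousLinearEquiv.refl ℝ E : E ≃L[ℝ] E) : E →L[ℝ] E) P := hd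
  set H := hd'.toOpenPartialHomeomorph h with hH
  have hPs : P ∈ H.source := hd'.mem_toOpenPartialHomeomorph_source
  have hHP : H P = 0 := hP
  have h0t : (0 : E) ∈ H.target := hHP ▸ H.map_source hPs
  have hsymm0 : H.symm 0 = P := by rw [← hHP, H.left_inv hPs]
  obtain ⟨R, hR, hRsub⟩ : ∃ R > 0, Metric.ball (0 : E) R ⊆
      H.target ∩ H.symm ⁻¹' Metric.ball P δ := by
    apply Metric.mem_nhds_iff.1
    refine inter_mem (H.open_target.mem_nhds h0t) ?_
    exact (H.continuousAt_symm h0t).preimage_mem_nhds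
      (by rw [hsymm0]; exact Metric.ball_mem_nhds P hδ)
  have hsmall : ∀ᶠ ε in 𝓝[>] (0 : ℝ), ε ∈ Set.Ioo 0 (min δ (R / 2)) :=
    Ioo_mem_nhdsGT (by positivity)
  filter_upwards [hsmall] with ε hε w hw
  have hε0 : 0 < ε := hε.1
  have hεδ : ε < δ := hε.2.trans_le (min_le_left _ _)
  have hεR : ε < R / 2 := hε.2.trans_le (min_le_right _ _)
  have hwpos : 0 < ‖w‖ := norm_pos_iff.2 hw
  have hPb : P ∈ Metric.ball P δ := Metric.mem_ball_self hδ
  apply existsUnique_of_exists_of_unique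
  -- Chosen so that ‖T • w‖ = 5ε/4. As ‖h x‖ ≤ (5/4) ‖x - P‖, the preimage of `T • w` is at distance
  -- at least ε from `P`; the preimage of 0 is `P` itself.
  · set T : ℝ := 5 / 4 * ε / ‖w‖ with hT
    have hT0 : 0 ≤ T := by positivity
    have hmem : ∀ t ∈ Set.Icc 0 T, t • w ∈ Metric.ball (0 : E) R := by
      intro t ht
      rw [mem_ball_zero_iff, norm_smul, Real.norm_of_nonneg ht.1]
      calc t * ‖w‖ ≤ T * ‖w‖ := by gcongr; exact ht.2
        _ = 5 / 4 * ε := by rw [hT]; field_simp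
        _ < R := by linarith
    have hcont : ContinuousOn (fun t : ℝ => ‖H.symm (t • w) - P‖) (Set.Icc 0 T) := by
      refine ((H.continuousOn_symm.comp (by fun_prop) ?_).sub continuousOn_const).norm
      exact fun t ht => (hRsub (hmem t ht)).1
    have hinv : ∀ t ∈ Set.Icc 0 T, h (H.symm (t • w)) = t • w := fun t ht =>
      H.right_inv (hRsub (hmem t ht)).1
    have hε_mem : ε ∈ Set.Icc ‖H.symm ((0 : ℝ) • w) - P‖ ‖H.symm (T • w) - P‖ := by
      refine ⟨by simp [hsymm0, hε0.le], ?_⟩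
      have hTm : T ∈ Set.Icc 0 T := ⟨hT0, le_rfl⟩
      have h1 := hnear _ (hRsub (hmem T hTm)).2 P hPb
      rw [hinv T hTm, hP, sub_zero] at h1
      have h2 : ‖T • w‖ = 5 / 4 * ε := by
        rw [norm_smul, Real.norm_of_nonneg hT0, hT]; field_simp
      have h3 := norm_le_norm_add_norm_sub (H.symm (T • w) - P) (T • w)
      rw [norm_sub_rev] at h1
      linarith
    obtain ⟨t, ht, hte⟩ := intermediate_value_Icc hT0 hcont hε_mem
    refine ⟨H.symm (t • w), by simpa [dist_eq_norm] using hte, t, ?_, hinv t ht⟩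
    rcases ht.1.eq_or_lt with h0 | h0
    · rw [← h0] at hte
      simp [hsymm0] at hte
      exact absurd hte hε0.ne
    · exact h0
  · have key : ∀ x₁ x₂ : E, ∀ t₁ t₂ : ℝ, x₁ ∈ Metric.sphere P ε → x₂ ∈ Metric.sphere P ε →
        0 < t₁ → t₁ ≤ t₂ → h x₁ = t₁ • w → h x₂ = t₂ • w → x₁ = x₂ := by
      intro x₁ x₂ t₁ t₂ hx₁ hx₂ ht₁ ht h₁ h₂
      have hb₁ : x₁ ∈ Metric.ball P δ := by
        rw [Metric.mem_ball, Metric.mem_sphere.1 hx₁]; exact hεδ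
      have hb₂ : x₂ ∈ Metric.ball P δ := by
        rw [Metric.mem_ball, Metric.mem_sphere.1 hx₂]; exact hεδ
      have n₁ := hnear x₁ hb₁ P hPb
      have n₂ := hnear x₂ hb₂ x₁ hb₁
      rw [h₁, hP, sub_zero] at n₁
      rw [h₁, h₂, ← sub_smul] at n₂
      -- The vectors x₁ - P and x₂ - x₁ are close to nonnegative multiples of `w`, so they do not
      -- form an obtuse angle. With ‖x₂ - P‖ = ‖x₁ - P‖, expanding the square forces x₂ = x₁.
      have hin := inner_nonneg_of_near_ray (sub_nonneg.2 ht) ht₁.le n₁ n₂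
      have hsq := norm_add_sq_real (x₁ - P) (x₂ - x₁)
      rw [sub_add_sub_comm, add_comm x₁, ← sub_add_sub_comm, sub_self, add_zero] at hsq
      rw [mem_sphere_iff_norm] at hx₁ hx₂
      rw [hx₁, hx₂] at hsq
      have : ‖x₂ - x₁‖ = 0 := by nlinarith [sq_nonneg ‖x₂ - x₁‖]
      exact (sub_eq_zero.1 (norm_eq_zero.1 this)).symm
    rintro x₁ x₂ ⟨hx₁, t₁, ht₁, h₁⟩ ⟨hx₂, t₂, ht₂, h₂⟩
    rcases le_total t₁ t₂ with ht | ht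
    · exact key x₁ x₂ t₁ t₂ hx₁ hx₂ ht₁ ht h₁ h₂
    · exact (key x₂ x₁ t₂ t₁ hx₂ hx₁ ht₂ ht h₂ h₁).symm

end NearIdentity

/-! ### A rank-two perturbation of the identity -/

section Determinant

variable {E : Type*} [NormedAddCommGroup E] [InnerProductSpace ℝ E] [FiniteDimensional ℝ E]

/-- The matrix is 1 + U V with U having the two columns -n and z, so det(1 + U V) = det(1 + V U)
reduces the computation to a 2×2 determinant. -/
theorem det_id_sub_add (n z : E) (hn : ‖n‖ = 1) (l : E →L[ℝ] ℝ) :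
    (ContinuousLinearMap.id ℝ E - (innerSL ℝ n).smulRight n + l.smulRight z).det
      = l n * inner ℝ n z := by
  set b := stdOrthonormalBasis ℝ E
  let U : Matrix (Fin (Module.finrank ℝ E)) (Fin 2) ℝ :=
    Matrix.of fun i => ![- inner ℝ (b i) n, inner ℝ (b i) z]
  let V : Matrix (Fin 2) (Fin (Module.finrank ℝ E)) ℝ :=
    Matrix.of ![fun j => inner ℝ n (b j), fun j => l (b j)]
  have hM : LinearMap.toMatrix b.toBasis b.toBasis
      (ContinuousLinearMap.id ℝ E - (innerSL ℝ n).smulRight n + l.smulRight z : E →L[ℝ] E)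
      = 1 + U * V := by
    ext i j
    simp [LinearMap.toMatrix_apply, U, V, Matrix.mul_apply, Fin.sum_univ_two, Matrix.one_apply,
      b.repr_apply_apply]
    ring
  have hl : ∀ v : E, ∑ j, l (b j) * inner ℝ (b j) v = l v := by
    intro v
    conv_rhs => rw [← b.sum_repr v]
    simp [b.repr_apply_apply, mul_comm]
  have hi : ∀ v : E, ∑ j, inner ℝ n (b j) * inner ℝ (b j) v = inner ℝ n v :=
    fun v => b.sum_inner_mul_inner n v
  rw [ContinuousLinearMap.det, ← LinearMap.det_toMatrix b.toBasis, hM,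
    Matrix.det_one_add_mul_comm, Matrix.det_fin_two]
  have h00 : (V * U) 0 0 = -1 := by
    simp [U, V, Matrix.mul_apply, Finset.sum_neg_distrib, hi, hn]
  have h01 : (V * U) 0 1 = inner ℝ n z := by simp [U, V, Matrix.mul_apply, hi]
  have h10 : (V * U) 1 0 = -l n := by
    simp [U, V, Matrix.mul_apply, Finset.sum_neg_distrib, hl]
  simp only [Matrix.add_apply, h00, h01, h10, Matrix.one_apply_eq, ne_eq, zero_ne_one, one_ne_zero,
    not_false_eq_true, Matrix.one_apply_ne]
  ring

end Determinant

/-! ### The Jacobian of the normalized map on a sphere -/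

section Cone

theorem radial_mem_sphere {P x : R4} (hx : x ≠ P) {ε : ℝ} (hε : 0 < ε) :
    P + (ε / ‖x - P‖) • (x - P) ∈ Metric.sphere P ε := by
  have : ‖x - P‖ ≠ 0 := norm_ne_zero_iff.2 (sub_ne_zero.2 hx)
  rw [mem_sphere_iff_norm, add_sub_cancel_left, norm_smul, norm_div, norm_norm,
    Real.norm_of_nonneg hε.le]
  field_simp

theorem hasFDerivAt_norm_sub {P x : R4} {ε : ℝ} (hε : 0 < ε) (hx : x ∈ Metric.sphere P ε) :
    HasFDerivAt (fun y => ‖y - P‖) (innerSL ℝ (ε⁻¹ • (x - P))) x := by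
  rw [mem_sphere_iff_norm] at hx
  have h1 : HasFDerivAt (fun y : R4 => ‖y - P‖ ^ 2) (2 • (innerSL ℝ (x - P)).comp
      (ContinuousLinearMap.id ℝ R4)) x := ((hasFDerivAt_id x).sub_const P).norm_sq
  have h2 := h1.sqrt (by rw [hx]; positivity)
  simp only [Real.sqrt_sq (norm_nonneg _)] at h2
  convert! h2 using 1
  ext v
  simp [hx]
  field_simp

theorem hasFDerivAt_radial {P x : R4} {ε : ℝ} (hε : 0 < ε) (hx : x ∈ Metric.sphere P ε) :
    HasFDerivAt (fun y => P + (ε / ‖y - P‖) • (y - P))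
      (ContinuousLinearMap.id ℝ R4 -
        (innerSL ℝ (ε⁻¹ • (x - P))).smulRight (ε⁻¹ • (x - P))) x := by
  have hn := hasFDerivAt_norm_sub hε hx
  rw [mem_sphere_iff_norm] at hx
  have h0 : ‖x - P‖ ≠ 0 := by rw [hx]; exact hε.ne'
  have h1 := (((hasDerivAt_inv h0).comp_hasFDerivAt x hn).const_mul ε).smul
    ((hasFDerivAt_id x).sub_const P)
  have h2 := h1.const_add P
  convert! h2 using 1
  ext1 v
  simp [hx, smul_smul]
  match_scalars <;> field_simp

/-- Radial retraction differentiates to the projection R killing the normal n. All other terms of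
the derivative, from the radial factor and from 1/‖φ‖, point along φ x. Writing φ x as the image of
z under Dφ(x) pulls Dφ(x) out as a left factor and leaves R plus a rank-one map. -/
theorem det_fderiv_coneExtension {φ : R4 → R4} {P x z : R4} {ε : ℝ} (hε : 0 < ε)
    (hx : x ∈ Metric.sphere P ε) (hφ : DifferentiableAt ℝ φ x) (h0 : φ x ≠ 0)
    (hz : fderiv ℝ φ x z = φ x) :
    sphereJacobian P ε (fun y => ‖φ y‖⁻¹ • φ y) x =
      ‖φ x‖⁻¹ ^ 4 * ((fderiv ℝ φ x).det * (ε⁻¹ ^ 2 * inner ℝ (x - P) z)) := by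
  have hr := hasFDerivAt_radial hε hx
  have hn := hasFDerivAt_norm_sub hε hx
  have hxn : ‖x - P‖ = ε := mem_sphere_iff_norm.1 hx
  have hρx : P + (ε / ‖x - P‖) • (x - P) = x := by
    rw [hxn, div_self hε.ne']; simp
  set n := ε⁻¹ • (x - P) with hndef
  have hn1 : ‖n‖ = 1 := by
    rw [hndef, norm_smul, hxn, norm_inv, Real.norm_of_nonneg hε.le, inv_mul_cancel₀ hε.ne']
  set R : R4 →L[ℝ] R4 := ContinuousLinearMap.id ℝ R4 - (innerSL ℝ n).smulRight n with hR
  have hRn : R n = 0 := by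
    simp [hR, hn1]
  set B := fderiv ℝ φ x with hB
  have hm : DifferentiableAt ℝ (fun y => ‖φ y‖⁻¹) x :=
    (hφ.norm ℝ h0).inv (norm_ne_zero_iff.2 h0)
  set m' := fderiv ℝ (fun y => ‖φ y‖⁻¹) x with hm'
  have h1 : HasFDerivAt (fun y => φ (P + (ε / ‖y - P‖) • (y - P))) (B.comp R) x :=
    HasFDerivAt.comp (g := φ) x (by rw [hρx]; exact hφ.hasFDerivAt) hr
  have h2 : HasFDerivAt (fun y => ‖φ (P + (ε / ‖y - P‖) • (y - P))‖⁻¹) (m'.comp R) x :=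
    HasFDerivAt.comp (g := fun y => ‖φ y‖⁻¹) x (by rw [hρx]; exact hm.hasFDerivAt) hr
  have h3 := (hn.mul_const ε⁻¹).smul (h2.smul h1)
  rw [hρx] at h3
  -- `l` collects the coefficients of φ x, scaled by ‖φ x‖. Since R n = 0, only the radial factor
  -- contributes to l n.
  set l : R4 →L[ℝ] ℝ := ε⁻¹ • innerSL ℝ n + ‖φ x‖ • m'.comp R with hl
  have hder : fderiv ℝ (coneExtension P ε (fun y => ‖φ y‖⁻¹ • φ y)) x =
      ‖φ x‖⁻¹ • B.comp (R + l.smulRight z) := by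
    refine HasFDerivAt.fderiv ?_
    convert! h3 using 1
    ext1 v
    simp [hl, hz, hxn, hε.ne', add_smul, smul_smul]
    rw [inv_mul_cancel_left₀ (norm_ne_zero_iff.2 h0)]
    module
  have hln : l n = ε⁻¹ := by simp [hl, hRn, hn1]
  rw [sphereJacobian, hder]
  have hfr : Module.finrank ℝ R4 = 4 := by simp
  have hdet : (‖φ x‖⁻¹ • B.comp (R + l.smulRight z)).det =
      ‖φ x‖⁻¹ ^ 4 * (B.det * (R + l.smulRight z).det) := by
    rw [ContinuousLinearMap.det, ContinuousLinearMap.toLinearMap_smul, LinearMap.det_smul, hfr,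
      ContinuousLinearMap.toLinearMap_comp, LinearMap.det_comp]
  rw [hdet, hR, det_id_sub_add n z hn1 l, hln, hndef, real_inner_smul_left]
  ring

theorem contDiffOn_coneExtension {φ : R4 → R4} {P : R4} {ε : ℝ} (hε : 0 < ε)
    (hφ : ContDiff ℝ (⊤ : ℕ∞) φ) (h0 : ∀ x ∈ Metric.sphere P ε, φ x ≠ 0) :
    ContDiffOn ℝ (⊤ : ℕ∞) (coneExtension P ε (fun y => ‖φ y‖⁻¹ • φ y)) {P}ᶜ := by
  intro x hx
  have hxP : x - P ≠ 0 := sub_ne_zero.2 hx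
  have hsub : ContDiffAt ℝ (⊤ : ℕ∞) (fun y : R4 => y - P) x := by fun_prop
  have hnorm : ContDiffAt ℝ (⊤ : ℕ∞) (fun y : R4 => ‖y - P‖) x := hsub.norm ℝ hxP
  have hr : ContDiffAt ℝ (⊤ : ℕ∞) (fun y => P + (ε / ‖y - P‖) • (y - P)) x :=
    contDiffAt_const.add ((contDiffAt_const.div hnorm (norm_ne_zero_iff.2 hxP)).smul hsub)
  have hφr : ContDiffAt ℝ (⊤ : ℕ∞) (fun y => φ (P + (ε / ‖y - P‖) • (y - P))) x :=
    ContDiffAt.comp x hφ.contDiffAt hr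
  have hne : φ (P + (ε / ‖x - P‖) • (x - P)) ≠ 0 := h0 _ (radial_mem_sphere hx hε)
  exact ((hnorm.div_const ε).smul
    (((hφr.norm ℝ hne).inv (norm_ne_zero_iff.2 hne)).smul hφr)).contDiffWithinAt

/-- Every signed count has exactly one term, equal to σ, and every point of the unit sphere is a
regular value. -/
theorem hasMappingDegree_of_existsUnique {φ : R4 → R4} {P : R4} {ε : ℝ} (hε : 0 < ε) {σ : SignType}
    (hσ : σ ≠ 0) (hφ : ContDiff ℝ (⊤ : ℕ∞) φ) (h0 : ∀ x ∈ Metric.sphere P ε, φ x ≠ 0)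
    (hray : ∀ y : R4, y ≠ 0 → ∃! x, x ∈ Metric.sphere P ε ∧ ∃ t : ℝ, 0 < t ∧ φ x = t • y)
    (hsign : ∀ x ∈ Metric.sphere P ε,
      SignType.sign (sphereJacobian P ε (fun y => ‖φ y‖⁻¹ • φ y) x) = σ) :
    HasMappingDegree P ε (fun y => ‖φ y‖⁻¹ • φ y) (σ : ℤ) := by
  have hpre : ∀ y ∈ Metric.sphere (0 : R4) 1, ∃ x ∈ Metric.sphere P ε,
      {x ∈ Metric.sphere P ε | ‖φ x‖⁻¹ • φ x = y} = {x} := by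
    intro y hy
    rw [mem_sphere_zero_iff_norm] at hy
    obtain ⟨x, ⟨hx, t, ht, hxt⟩, huniq⟩ := hray y (by rintro rfl; simp at hy)
    refine ⟨x, hx, Set.eq_singleton_iff_unique_mem.2 ⟨⟨hx, ?_⟩, ?_⟩⟩
    · rw [hxt, norm_smul, hy, Real.norm_of_nonneg ht.le, mul_one, inv_smul_smul₀ ht.ne']
    · rintro x' ⟨hx', hxy⟩
      have hpos := norm_pos_iff.2 (h0 x' hx')
      exact huniq x' ⟨hx', ‖φ x'‖, hpos, by rw [← hxy, smul_inv_smul₀ hpos.ne']⟩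
  have hreg : ∀ x ∈ Metric.sphere P ε,
      sphereJacobian P ε (fun y => ‖φ y‖⁻¹ • φ y) x ≠ 0 := by
    intro x hx h
    apply hσ
    rw [← hsign x hx, h, sign_zero]
  refine ⟨?_, contDiffOn_coneExtension hε hφ h0, ?_, ?_, ?_⟩
  · intro x hx
    have hpos := norm_pos_iff.2 (h0 x hx)
    rw [mem_sphere_zero_iff_norm, norm_smul, norm_inv, norm_norm, inv_mul_cancel₀ hpos.ne']
  · exact ⟨EuclideanSpace.single 0 1, by simp, fun x hx _ => hreg x hx⟩
  · intro y hy
    obtain ⟨x, -, hxy⟩ := hpre y hy.1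
    rw [hxy]
    exact Set.finite_singleton x
  · intro y hy
    obtain ⟨x, hx, hxy⟩ := hpre y hy.1
    rw [hxy, finsum_mem_singleton, hsign x hx]

end Cone

/-- Near a zero at which its differential is invertible, a smooth map has no other zero, and its
normalization on small spheres has mapping degree the sign of the Jacobian determinant. -/
theorem eventually_hasMappingDegree {φ : R4 → R4} {P : R4} (hφ : ContDiff ℝ (⊤ : ℕ∞) φ)
    (hP : φ P = 0) (hdet : (fderiv ℝ φ P).det ≠ 0) :
    ∀ᶠ ε in 𝓝[>] (0 : ℝ), (∀ x ∈ Metric.closedBall P ε, φ x = 0 → x = P) ∧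
      HasMappingDegree P ε (fun y => ‖φ y‖⁻¹ • φ y)
        (SignType.sign (fderiv ℝ φ P).det : ℤ) := by
  set A : R4 ≃L[ℝ] R4 := (fderiv ℝ φ P).toContinuousLinearEquivOfDetNeZero hdet with hA
  have hAc : (A : R4 →L[ℝ] R4) = fderiv ℝ φ P := by ext1 v; rfl
  set h : R4 → R4 := fun x => A.symm (φ x) with hh
  have hstrict : HasStrictFDerivAt φ (fderiv ℝ φ P) P :=
    hφ.contDiffAt.hasStrictFDerivAt (by simp)
  have hhs : HasStrictFDerivAt h (ContinuousLinearMap.id ℝ R4) P := by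
    have := (A.symm : R4 →L[ℝ] R4).hasStrictFDerivAt.comp P hstrict
    rw [← hAc, A.coe_symm_comp_coe] at this
    exact this
  have hhP : h P = 0 := by simp [hh, hP]
  have hcont : Continuous (fderiv ℝ φ) := hφ.continuous_fderiv (by simp)
  have hsgn : ∀ᶠ x in 𝓝 P, SignType.sign (fderiv ℝ φ x).det =
      SignType.sign (fderiv ℝ φ P).det := by
    have hc : Continuous fun x => (fderiv ℝ φ x).det :=
      ContinuousLinearMap.continuous_det.comp hcont
    rcases hdet.lt_or_gt with hlt | hlt
    · filter_upwards [hc.continuousAt.eventually_lt continuousAt_const hlt] with x hx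
      rw [sign_neg hx, sign_neg hlt]
    · filter_upwards [continuousAt_const.eventually_lt hc.continuousAt hlt] with x hx
      rw [sign_pos hx, sign_pos hlt]
  -- A⁻¹ Dφ(x) tends to the identity as x tends to P. This will compare z, the solution of Dφ(x) z =
  -- φ x, with h x = A⁻¹ φ x.
  have hclose : ∀ᶠ x in 𝓝 P, ∀ z : R4, ‖A.symm (fderiv ℝ φ x z) - z‖ ≤ ‖z‖ / 4 := by
    have hc : Continuous fun x => ‖(A.symm : R4 →L[ℝ] R4).comp (fderiv ℝ φ x) -
        ContinuousLinearMap.id ℝ R4‖ :=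
      ((continuous_const.clm_comp hcont).sub continuous_const).norm
    have h0 : ‖(A.symm : R4 →L[ℝ] R4).comp (fderiv ℝ φ P) - ContinuousLinearMap.id ℝ R4‖
        < 1 / 4 := by
      rw [← hAc, A.coe_symm_comp_coe, sub_self, norm_zero]
      norm_num
    filter_upwards [hc.continuousAt.eventually_lt continuousAt_const h0] with x hx z
    have := ((A.symm : R4 →L[ℝ] R4).comp (fderiv ℝ φ x) -
      ContinuousLinearMap.id ℝ R4).le_of_opNorm_le hx.le z
    simpa [div_eq_inv_mul] using this
  obtain ⟨δ, hδ, hnear⟩ := exists_ball_near_id hhs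
  obtain ⟨δ', hδ', hloc⟩ := Metric.eventually_nhds_iff_ball.1 (hsgn.and hclose)
  filter_upwards [eventually_existsUnique_sphere_ray hhP hhs,
    Ioo_mem_nhdsGT (lt_min hδ hδ')] with ε hray hε
  have hzero : ∀ x ∈ Metric.closedBall P ε, φ x = 0 → x = P := by
    intro x hx hx0
    have hxb : x ∈ Metric.ball P δ :=
      Metric.mem_ball.2 ((Metric.mem_closedBall.1 hx).trans_lt (hε.2.trans_le (min_le_left _ _)))
    have h1 := hnear x hxb P (Metric.mem_ball_self hδ)
    have hhx : h x = 0 := by simp [hh, hx0]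
    rw [hhx, hhP, sub_zero, zero_sub, norm_neg] at h1
    have h2 := norm_nonneg (x - P)
    exact sub_eq_zero.1 (norm_eq_zero.1 (by linarith))
  have hne : ∀ x ∈ Metric.sphere P ε, φ x ≠ 0 := by
    intro x hx hx0
    have := hzero x (Metric.sphere_subset_closedBall hx) hx0
    rw [this, Metric.mem_sphere, dist_self] at hx
    exact hε.1.ne hx
  refine ⟨hzero, hasMappingDegree_of_existsUnique hε.1 (by rwa [ne_eq, sign_eq_zero_iff]) hφ hne
    ?_ ?_⟩
  · intro y hy
    convert! hray (A.symm y) (by simpa using hy) using 6 with x t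
    simp only [hh]
    rw [← map_smul, A.symm.injective.eq_iff]
  · intro x hx
    have hxb : x ∈ Metric.ball P δ :=
      Metric.mem_ball.2 ((Metric.mem_sphere.1 hx).trans_lt (hε.2.trans_le (min_le_left _ _)))
    obtain ⟨hs, hc⟩ := hloc x
      (Metric.mem_ball.2 ((Metric.mem_sphere.1 hx).trans_lt (hε.2.trans_le (min_le_right _ _))))
    have hdx : (fderiv ℝ φ x).det ≠ 0 := by
      rwa [← sign_ne_zero, hs, sign_ne_zero]
    obtain ⟨z, hz⟩ : ∃ z, fderiv ℝ φ x z = φ x :=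
      ((fderiv ℝ φ x).toContinuousLinearEquivOfDetNeZero hdx).surjective (φ x)
    have hxP : x - P ≠ 0 := by
      rw [← norm_ne_zero_iff, mem_sphere_iff_norm.1 hx]; exact hε.1.ne'
    have h1 := hnear x hxb P (Metric.mem_ball_self hδ)
    rw [hhP, sub_zero] at h1
    have h2 := hc z
    rw [hz] at h2
    -- The intermediate point is h x, which is close both to x - P and to z.
    have hpos : 0 < inner ℝ (x - P) z := inner_pos_of_near hxP h1 h2
    rw [det_fderiv_coneExtension hε.1 hx (hφ.differentiable (by simp) x) (hne x hx) hz, ← hs]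
    have hn := norm_pos_iff.2 (hne x hx)
    have hε0 := hε.1
    rw [sign_mul, sign_mul, sign_pos (by positivity : 0 < ‖φ x‖⁻¹ ^ 4),
      sign_pos (by positivity : 0 < ε⁻¹ ^ 2 * inner ℝ (x - P) z), one_mul, mul_one]

/-! ### Orientation of frames through Gram matrices -/

theorem frameDet_mul (u₁ u₂ u₃ u₄ a₁ a₂ a₃ a₄ : R4) :
    frameDet u₁ u₂ u₃ u₄ * frameDet a₁ a₂ a₃ a₄ =
      Matrix.det !![inner ℝ u₁ a₁, inner ℝ u₁ a₂, inner ℝ u₁ a₃, inner ℝ u₁ a₄;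
        inner ℝ u₂ a₁, inner ℝ u₂ a₂, inner ℝ u₂ a₃, inner ℝ u₂ a₄;
        inner ℝ u₃ a₁, inner ℝ u₃ a₂, inner ℝ u₃ a₃, inner ℝ u₃ a₄;
        inner ℝ u₄ a₁, inner ℝ u₄ a₂, inner ℝ u₄ a₃, inner ℝ u₄ a₄] := by
  rw [frameDet, frameDet, ← Matrix.det_transpose (Matrix.of ![⇑a₁, ⇑a₂, ⇑a₃, ⇑a₄]),
    ← Matrix.det_mul]
  congr 1
  ext i j
  fin_cases i <;> fin_cases j <;>
    simp [Matrix.mul_apply, PiLp.inner_apply, mul_comm]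

/-- No sign appears, because exchanging two blocks of two columns is an even permutation. -/
theorem det_four_of_upper_left_zero (a b c d e f g h i j k l : ℝ) :
    Matrix.det !![0, 0, a, b; 0, 0, c, d; e, f, i, j; g, h, k, l] =
      (a * d - b * c) * (e * h - f * g) := by
  simp [Matrix.det_succ_row_zero, Fin.sum_univ_succ, Fin.succAbove]
  ring

theorem det_four_of_upper_right_zero (a b c d e f g h i j k l : ℝ) :
    Matrix.det !![a, b, 0, 0; c, d, 0, 0; i, j, e, f; k, l, g, h] =
      (a * d - b * c) * (e * h - f * g) := by
  simp [Matrix.det_succ_row_zero, Fin.sum_univ_succ, Fin.succAbove]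
  ring

theorem gram_nonneg (a b : R4) :
    0 ≤ inner ℝ a a * inner ℝ b b - inner ℝ a b * inner ℝ b a := by
  have := real_inner_mul_inner_self_le a b
  rw [real_inner_comm a b] at *
  linarith

/-- Equality in Cauchy–Schwarz would make ⟨a, a⟩ b - ⟨a, b⟩ a vanish; pairing it with y gives ⟨a, a⟩
= 0, against ⟨x, a⟩ = 1. -/
theorem gram_pos_of_dual {a b x y : R4} (hxa : inner ℝ x a = (1 : ℝ)) (hya : inner ℝ y a = (0 : ℝ))
    (hyb : inner ℝ y b = (1 : ℝ)) :
    0 < inner ℝ a a * inner ℝ b b - inner ℝ a b * inner ℝ b a := by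
  refine (gram_nonneg a b).lt_of_ne fun h => ?_
  have ha : a ≠ 0 := by rintro rfl; simp at hxa
  have hw : inner ℝ a a • b - inner ℝ a b • a = 0 := by
    rw [← inner_self_eq_zero (𝕜 := ℝ)]
    simp only [inner_sub_left, inner_sub_right, real_inner_smul_left, real_inner_smul_right]
    linear_combination -inner ℝ a a * h
  have h1 : inner ℝ y (inner ℝ a a • b - inner ℝ a b • a) = (0 : ℝ) := by rw [hw, inner_zero_right]
  rw [inner_sub_right, real_inner_smul_right, real_inner_smul_right, hya, hyb] at h1
  exact ha (inner_self_eq_zero.1 (by linarith : inner ℝ a a = (0 : ℝ)))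

/-- If `(u₁, u₂)` and `(v₁, v₂)` are positive frames of the orthogonal complements of `(a₁, a₂)`
and `(b₁, b₂)`, then `(u₁, u₂, v₁, v₂)` and `(a₁, a₂, b₁, b₂)` have the same orientation. -/
theorem frameDet_mul_frameDet_pos {u₁ u₂ v₁ v₂ a₁ a₂ b₁ b₂ : R4}
    (h11 : inner ℝ u₁ a₁ = (0 : ℝ)) (h12 : inner ℝ u₁ a₂ = (0 : ℝ))
    (h21 : inner ℝ u₂ a₁ = (0 : ℝ)) (h22 : inner ℝ u₂ a₂ = (0 : ℝ))
    (k11 : inner ℝ v₁ b₁ = (0 : ℝ)) (k12 : inner ℝ v₁ b₂ = (0 : ℝ))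
    (k21 : inner ℝ v₂ b₁ = (0 : ℝ)) (k22 : inner ℝ v₂ b₂ = (0 : ℝ))
    (hu : 0 < frameDet u₁ u₂ a₁ a₂) (hv : 0 < frameDet v₁ v₂ b₁ b₂)
    (hD : frameDet a₁ a₂ b₁ b₂ ≠ 0) :
    0 < frameDet u₁ u₂ v₁ v₂ * frameDet a₁ a₂ b₁ b₂ := by
  have e1 := frameDet_mul u₁ u₂ a₁ a₂ a₁ a₂ b₁ b₂
  have e2 := frameDet_mul v₁ v₂ b₁ b₂ a₁ a₂ b₁ b₂
  have e3 := frameDet_mul u₁ u₂ v₁ v₂ a₁ a₂ b₁ b₂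
  rw [h11, h12, h21, h22, det_four_of_upper_left_zero] at e1 e3
  rw [k11, k12, k21, k22, det_four_of_upper_right_zero] at e2
  -- Now det(u, a) * D is p times the Gram determinant of a, det(v, b) * D is q times that of b, and
  -- det(u, v) * D = p * q, with p and q as set below.
  rw [e3]
  have ga := gram_nonneg a₁ a₂
  have gb := gram_nonneg b₁ b₂
  set p := inner ℝ u₁ b₁ * inner ℝ u₂ b₂ - inner ℝ u₁ b₂ * inner ℝ u₂ b₁
  set q := inner ℝ v₁ a₁ * inner ℝ v₂ a₂ - inner ℝ v₁ a₂ * inner ℝ v₂ a₁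
  rcases hD.lt_or_gt with h | h
  · have hp : p < 0 := by
      by_contra! hp
      exact absurd (e1 ▸ mul_nonneg hp ga) (not_le.2 (mul_neg_of_pos_of_neg hu h))
    have hq : q < 0 := by
      by_contra! hq
      exact absurd (e2 ▸ mul_nonneg hq gb) (not_le.2 (mul_neg_of_pos_of_neg hv h))
    exact mul_pos_of_neg_of_neg hp hq
  · have hp : 0 < p := pos_of_mul_pos_left (e1 ▸ mul_pos hu h) ga
    have hq : 0 < q := pos_of_mul_pos_left (e2 ▸ mul_pos hv h) gb
    exact mul_pos hp hq

/-! ### Differentials and gradients of mixed polynomials -/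

theorem contDiff_value (f : MixedPolynomial) : ContDiff ℝ (⊤ : ℕ∞) (value f) := by
  have hcoord : ∀ i, ContDiff ℝ (⊤ : ℕ∞) fun p : R4 => ((p i : ℝ) : ℂ) := fun i =>
    Complex.ofRealCLM.contDiff.comp (by fun_prop)
  have hz : ∀ j, ContDiff ℝ (⊤ : ℕ∞) fun p : R4 => toC2 p j := by
    intro j
    fin_cases j
    · simpa [toC2, Complex.mk_eq_add_mul_I] using (hcoord 0).add ((hcoord 1).mul contDiff_const)
    · simpa [toC2, Complex.mk_eq_add_mul_I] using (hcoord 2).add ((hcoord 3).mul contDiff_const)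
  induction f using MvPolynomial.induction_on with
  | C a =>
    have h : value (MvPolynomial.C a) = fun _ => a := by funext x; simp [value]
    rw [h]
    exact contDiff_const
  | add p q hp hq =>
    have h : value (p + q) = fun x => value p x + value q x := by funext x; simp [value]
    rw [h]
    exact hp.add hq
  | mul_X p i hp =>
    have hi : ContDiff ℝ (⊤ : ℕ∞) fun x : R4 =>
        Sum.elim (toC2 x) (fun j => (starRingEnd ℂ) (toC2 x j)) i := by
      rcases i with j | j
      · exact hz j
      · exact Complex.conjCLE.contDiff.comp (hz j)
    have h : value (p * MvPolynomial.X i) = fun x => value p x *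
        Sum.elim (toC2 x) (fun j => (starRingEnd ℂ) (toC2 x j)) i := by funext x; simp [value]
    rw [h]
    exact hp.mul hi

theorem hasFDerivAt_value (f : MixedPolynomial) (x : R4) :
    HasFDerivAt (value f) (fderiv ℝ (value f) x) x :=
  ((contDiff_value f).differentiable (by simp) x).hasFDerivAt

theorem hasFDerivAt_rePart (f : MixedPolynomial) (x : R4) :
    HasFDerivAt (rePart f) (Complex.reCLM.comp (fderiv ℝ (value f) x)) x :=
  Complex.reCLM.hasFDerivAt.comp x (hasFDerivAt_value f x)

theorem hasFDerivAt_imPart (f : MixedPolynomial) (x : R4) :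
    HasFDerivAt (imPart f) (Complex.imCLM.comp (fderiv ℝ (value f) x)) x :=
  Complex.imCLM.hasFDerivAt.comp x (hasFDerivAt_value f x)

theorem inner_gradient_rePart (f : MixedPolynomial) (x v : R4) :
    inner ℝ v (gradient (rePart f) x) = (fderiv ℝ (value f) x v).re := by
  rw [real_inner_comm, gradient, InnerProductSpace.toDual_symm_apply, (hasFDerivAt_rePart f x).fderiv]
  rfl

theorem inner_gradient_imPart (f : MixedPolynomial) (x v : R4) :
    inner ℝ v (gradient (imPart f) x) = (fderiv ℝ (value f) x v).im := by
  rw [real_inner_comm, gradient, InnerProductSpace.toDual_symm_apply, (hasFDerivAt_imPart f x).fderiv]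
  rfl

theorem mem_tangentSpace_iff {f : MixedPolynomial} {x v : R4} :
    v ∈ tangentSpace f x ↔
      inner ℝ v (gradient (rePart f) x) = (0 : ℝ) ∧
        inner ℝ v (gradient (imPart f) x) = (0 : ℝ) := by
  rw [inner_gradient_rePart, inner_gradient_imPart, tangentSpace, LinearMap.mem_ker]
  exact Complex.ext_iff

theorem contDiff_realMap (f g : MixedPolynomial) : ContDiff ℝ (⊤ : ℕ∞) (realMap f g) := by
  rw [contDiff_euclidean]
  have hre : ∀ f, ContDiff ℝ (⊤ : ℕ∞) (rePart f) := fun f =>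
    Complex.reCLM.contDiff.comp (contDiff_value f)
  have him : ∀ f, ContDiff ℝ (⊤ : ℕ∞) (imPart f) := fun f =>
    Complex.imCLM.contDiff.comp (contDiff_value f)
  intro i
  fin_cases i
  · exact hre f
  · exact him f
  · exact hre g
  · exact him g

theorem realMap_eq_zero_iff {f g : MixedPolynomial} {x : R4} :
    realMap f g x = 0 ↔ x ∈ curve f ∩ curve g := by
  have h : realMap f g x = 0 ↔ ∀ i, realMap f g x i = 0 := by
    rw [← WithLp.ofLp_eq_zero 2, funext_iff]
    rfl
  rw [h]
  simp [Fin.forall_fin_succ, realMap, rePart, imPart, curve, Complex.ext_iff, and_assoc]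

/-- The determinant of the gradients of the four real components of `(f, g)`. -/
theorem det_fderiv_realMap (f g : MixedPolynomial) (x : R4) :
    (fderiv ℝ (realMap f g) x).det =
      frameDet (gradient (rePart f) x) (gradient (imPart f) x)
        (gradient (rePart g) x) (gradient (imPart g) x) := by
  have hd : HasFDerivAt (realMap f g) (fderiv ℝ (realMap f g) x) x :=
    ((contDiff_realMap f g).differentiable (by simp) x).hasFDerivAt
  have hcomp : ∀ i, HasFDerivAt (fun y => realMap f g y i)
      ((EuclideanSpace.proj i).comp (fderiv ℝ (realMap f g) x)) x := fun i =>
    (EuclideanSpace.proj (𝕜 := ℝ) i).hasFDerivAt.comp x hd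
  have hrow : ∀ v : R4,
      fderiv ℝ (realMap f g) x v 0 = inner ℝ v (gradient (rePart f) x) ∧
      fderiv ℝ (realMap f g) x v 1 = inner ℝ v (gradient (imPart f) x) ∧
      fderiv ℝ (realMap f g) x v 2 = inner ℝ v (gradient (rePart g) x) ∧
      fderiv ℝ (realMap f g) x v 3 = inner ℝ v (gradient (imPart g) x) := by
    intro v
    simp only [inner_gradient_rePart, inner_gradient_imPart]
    exact ⟨congr($((hcomp 0).unique (hasFDerivAt_rePart f x)) v),
      congr($((hcomp 1).unique (hasFDerivAt_imPart f x)) v),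
      congr($((hcomp 2).unique (hasFDerivAt_rePart g x)) v),
      congr($((hcomp 3).unique (hasFDerivAt_imPart g x)) v)⟩
  rw [ContinuousLinearMap.det, frameDet,
    ← LinearMap.det_toMatrix (EuclideanSpace.basisFun (Fin 4) ℝ).toBasis]
  congr 1
  ext i j
  obtain ⟨h0, h1, h2, h3⟩ := hrow (EuclideanSpace.single j 1)
  simp only [EuclideanSpace.inner_single_left, map_one, one_mul] at h0 h1 h2 h3
  rw [LinearMap.toMatrix_apply]
  simp only [OrthonormalBasis.coe_toBasis, EuclideanSpace.basisFun_apply]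
  fin_cases i
  · simpa using h0
  · simpa using h1
  · simpa using h2
  · simpa using h3

/-! ### Transversality and invertibility of the differential -/

theorem linearIndependent_jacobian {f : MixedPolynomial} {x : R4} (h : (jacobian f x).rank = 2) :
    LinearIndependent ℝ (jacobian f x).row := by
  rw [linearIndependent_iff_card_eq_finrank_span, Set.finrank, ← Matrix.rank_eq_finrank_span_row, h]
  simp

theorem eq_zero_of_smul_add_smul_eq_zero {f : MixedPolynomial} {x : R4}
    (h : (jacobian f x).rank = 2) {c d : ℝ}
    (hcd : c • gradient (rePart f) x + d • gradient (imPart f) x = 0) : c = 0 ∧ d = 0 := by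
  have hl := linearIndependent_jacobian h
  rw [Fintype.linearIndependent_iff] at hl
  have h0 := hl ![c, d] (by
    ext j
    simpa [jacobian, Fin.sum_univ_two] using congrArg (fun w : R4 => w j) hcd)
  exact ⟨h0 0, h0 1⟩

theorem det_fderiv_realMap_ne_zero {f g : MixedPolynomial} {x : R4}
    (hf : (jacobian f x).rank = 2) (hg : (jacobian g x).rank = 2) (hfg : IsTransverse f g x) :
    (fderiv ℝ (realMap f g) x).det ≠ 0 := by
  rw [det_fderiv_realMap]
  intro h
  obtain ⟨c, hc, hc0⟩ := Matrix.exists_vecMul_eq_zero_iff.2 h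
  have hsum : c 0 • gradient (rePart f) x + c 1 • gradient (imPart f) x +
      (c 2 • gradient (rePart g) x + c 3 • gradient (imPart g) x) = 0 := by
    ext j
    have := congrFun hc0 j
    simp only [Matrix.vecMul, dotProduct, Fin.sum_univ_four] at this
    simpa [add_assoc] using this
  have hw : c 0 • gradient (rePart f) x + c 1 • gradient (imPart f) x = 0 := by
    set w := c 0 • gradient (rePart f) x + c 1 • gradient (imPart f) x with hwdef
    -- `w` is a combination of gradients of f and, by `hsum`, also one of gradients of g, so it is
    -- orthogonal to both tangent spaces.
    have hall : ∀ v ∈ tangentSpace f x ⊔ tangentSpace g x, inner ℝ v w = (0 : ℝ) := by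
      intro v hv
      obtain ⟨y, hy, z, hz, rfl⟩ := Submodule.mem_sup.1 hv
      rw [mem_tangentSpace_iff] at hy hz
      have h1 : inner ℝ y w = (0 : ℝ) := by
        rw [hwdef, inner_add_right, real_inner_smul_right, real_inner_smul_right, hy.1, hy.2]
        ring
      have h2 : inner ℝ z w = (0 : ℝ) := by
        rw [eq_neg_of_add_eq_zero_left hsum, inner_neg_right, inner_add_right,
          real_inner_smul_right, real_inner_smul_right, hz.1, hz.2]
        ring
      rw [inner_add_left, h1, h2, add_zero]
    rw [hfg] at hall
    exact inner_self_eq_zero.1 (hall w Submodule.mem_top)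
  rw [hw, zero_add] at hsum
  obtain ⟨h0, h1⟩ := eq_zero_of_smul_add_smul_eq_zero hf hw
  obtain ⟨h2, h3⟩ := eq_zero_of_smul_add_smul_eq_zero hg hsum
  apply hc
  ext i
  fin_cases i <;> assumption

/-- Invertibility is an open condition, so this makes both curves non-singular at all their points
near `P`, which is what the isolated-singularity requirement needs. -/
theorem rank_jacobian_of_det_ne_zero {f g : MixedPolynomial} {x : R4}
    (h : (fderiv ℝ (realMap f g) x).det ≠ 0) :
    (jacobian f x).rank = 2 ∧ (jacobian g x).rank = 2 := by
  rw [det_fderiv_realMap, frameDet] at h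
  have hl := Matrix.linearIndependent_rows_of_det_ne_zero h
  constructor
  · have : (jacobian f x).row = (Matrix.of ![⇑(gradient (rePart f) x), ⇑(gradient (imPart f) x),
        ⇑(gradient (rePart g) x), ⇑(gradient (imPart g) x)]).row ∘ ![0, 1] := by
      ext i j; fin_cases i <;> rfl
    have hr : LinearIndependent ℝ (jacobian f x).row := by
      rw [this]
      exact hl.comp _ (by decide)
    simpa using hr.rank_matrix
  · have : (jacobian g x).row = (Matrix.of ![⇑(gradient (rePart f) x), ⇑(gradient (imPart f) x),
        ⇑(gradient (rePart g) x), ⇑(gradient (imPart g) x)]).row ∘ ![2, 3] := by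
      ext i j; fin_cases i <;> rfl
    have hr : LinearIndependent ℝ (jacobian g x).row := by
      rw [this]
      exact hl.comp _ (by decide)
    simpa using hr.rank_matrix

/-- The dual basis of a basis given by the rows of an invertible matrix. -/
theorem exists_dual_frame {a₁ a₂ b₁ b₂ : R4} (h : frameDet a₁ a₂ b₁ b₂ ≠ 0) (y : Fin 4 → ℝ) :
    ∃ x : R4, inner ℝ x a₁ = y 0 ∧ inner ℝ x a₂ = y 1 ∧ inner ℝ x b₁ = y 2 ∧
      inner ℝ x b₂ = y 3 := by
  obtain ⟨x, hx⟩ := (Matrix.mulVec_surjective_iff_isUnit.2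
    ((Matrix.isUnit_iff_isUnit_det _).2 (isUnit_iff_ne_zero.2 h))) y
  have hi : ∀ a : R4, inner ℝ (WithLp.toLp 2 x) a = dotProduct (⇑a) x := fun a => by
    simp [PiLp.inner_apply, dotProduct]
  refine ⟨WithLp.toLp 2 x, ?_, ?_, ?_, ?_⟩
  · rw [hi, ← hx]; rfl
  · rw [hi, ← hx]; rfl
  · rw [hi, ← hx]; rfl
  · rw [hi, ← hx]; rfl

/-- In the dual basis, x₃, x₄ span the complement of a₁, a₂, and x₁, x₂ that of b₁, b₂. The product
of det(x₃, x₄, a₁, a₂) with the determinant of the gradients is a positive Gram determinant, and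
likewise for the other pair, so the sign of that determinant decides the order of the two vectors.
-/
theorem exists_pos_frames {a₁ a₂ b₁ b₂ : R4} (h : frameDet a₁ a₂ b₁ b₂ ≠ 0) :
    (∃ u₁ u₂ : R4, (inner ℝ u₁ a₁ = (0 : ℝ) ∧ inner ℝ u₁ a₂ = (0 : ℝ)) ∧
      (inner ℝ u₂ a₁ = (0 : ℝ) ∧ inner ℝ u₂ a₂ = (0 : ℝ)) ∧ 0 < frameDet u₁ u₂ a₁ a₂) ∧
    (∃ v₁ v₂ : R4, (inner ℝ v₁ b₁ = (0 : ℝ) ∧ inner ℝ v₁ b₂ = (0 : ℝ)) ∧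
      (inner ℝ v₂ b₁ = (0 : ℝ) ∧ inner ℝ v₂ b₂ = (0 : ℝ)) ∧ 0 < frameDet v₁ v₂ b₁ b₂) := by
  obtain ⟨x₁, h11, h12, h13, h14⟩ := exists_dual_frame h ![1, 0, 0, 0]
  obtain ⟨x₂, h21, h22, h23, h24⟩ := exists_dual_frame h ![0, 1, 0, 0]
  obtain ⟨x₃, h31, h32, h33, h34⟩ := exists_dual_frame h ![0, 0, 1, 0]
  obtain ⟨x₄, h41, h42, h43, h44⟩ := exists_dual_frame h ![0, 0, 0, 1]
  simp only [Matrix.cons_val] at *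
  have ga := gram_pos_of_dual h11 h21 h22
  have gb := gram_pos_of_dual h33 h43 h44
  have e1 := frameDet_mul x₃ x₄ a₁ a₂ a₁ a₂ b₁ b₂
  have e2 := frameDet_mul x₄ x₃ a₁ a₂ a₁ a₂ b₁ b₂
  have e3 := frameDet_mul x₁ x₂ b₁ b₂ a₁ a₂ b₁ b₂
  have e4 := frameDet_mul x₂ x₁ b₁ b₂ a₁ a₂ b₁ b₂
  rw [h31, h32, h41, h42, h33, h34, h43, h44, det_four_of_upper_left_zero] at e1 e2
  rw [h11, h12, h21, h22, h13, h14, h23, h24, det_four_of_upper_right_zero] at e3 e4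
  rcases h.lt_or_gt with hD | hD
  · exact ⟨⟨x₄, x₃, ⟨h41, h42⟩, ⟨h31, h32⟩, pos_of_mul_neg_left (by rw [e2]; linarith) hD.le⟩,
      ⟨x₂, x₁, ⟨h23, h24⟩, ⟨h13, h14⟩, pos_of_mul_neg_left (by rw [e4]; linarith) hD.le⟩⟩
  · exact ⟨⟨x₃, x₄, ⟨h31, h32⟩, ⟨h41, h42⟩, pos_of_mul_pos_left (by rw [e1]; linarith) hD.le⟩,
      ⟨x₁, x₂, ⟨h13, h14⟩, ⟨h23, h24⟩, pos_of_mul_pos_left (by rw [e3]; linarith) hD.le⟩⟩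

/-! ### Both intersection numbers as the sign of the Jacobian determinant -/

theorem isTopologicalIntersectionNumber_sign {f g : MixedPolynomial} {P : R4}
    (h : (fderiv ℝ (realMap f g) P).det ≠ 0) :
    IsTopologicalIntersectionNumber f g P (SignType.sign (fderiv ℝ (realMap f g) P).det : ℤ) := by
  rw [det_fderiv_realMap] at h ⊢
  obtain ⟨⟨u₁, u₂, hu₁, hu₂, hu⟩, ⟨v₁, v₂, hv₁, hv₂, hv⟩⟩ := exists_pos_frames h
  refine ⟨⟨u₁, u₂, mem_tangentSpace_iff.2 hu₁, mem_tangentSpace_iff.2 hu₂, hu⟩,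
    ⟨v₁, v₂, mem_tangentSpace_iff.2 hv₁, mem_tangentSpace_iff.2 hv₂, hv⟩, ?_⟩
  rintro u₁ u₂ v₁ v₂ ⟨hu₁, hu₂, hu⟩ ⟨hv₁, hv₂, hv⟩
  rw [mem_tangentSpace_iff] at hu₁ hu₂ hv₁ hv₂
  have hpos := frameDet_mul_frameDet_pos hu₁.1 hu₁.2 hu₂.1 hu₂.2 hv₁.1 hv₁.2 hv₂.1 hv₂.2 hu hv h
  rcases h.lt_or_gt with hD | hD
  · exact Or.inr ⟨neg_of_mul_pos_left hpos hD.le, by simp [sign_neg hD]⟩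
  · exact Or.inl ⟨pos_of_mul_pos_left hpos hD.le, by simp [sign_pos hD]⟩

theorem isLocalIntersectionNumber_sign {f g : MixedPolynomial} {P : R4} (hP : P ∈ curve f ∩ curve g)
    (h : (fderiv ℝ (realMap f g) P).det ≠ 0) :
    IsLocalIntersectionNumber f g P (SignType.sign (fderiv ℝ (realMap f g) P).det : ℤ) := by
  have hnear : ∀ᶠ q in 𝓝[{P}ᶜ] P, (fderiv ℝ (realMap f g) q).det ≠ 0 := by
    have hc : Continuous fun q => (fderiv ℝ (realMap f g) q).det :=
      ContinuousLinearMap.continuous_det.comp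
        ((contDiff_realMap f g).continuous_fderiv (by simp))
    exact (hc.continuousAt.eventually_ne h).filter_mono nhdsWithin_le_nhds
  refine ⟨?_, ?_, ?_⟩
  · filter_upwards [hnear] with q hq hqf
    exact ⟨hqf, (rank_jacobian_of_det_ne_zero hq).1⟩
  · filter_upwards [hnear] with q hq hqg
    exact ⟨hqg, (rank_jacobian_of_det_ne_zero hq).2⟩
  · filter_upwards [eventually_hasMappingDegree (contDiff_realMap f g)
      (realMap_eq_zero_iff.2 hP) h, self_mem_nhdsWithin] with ε hε hε0
    refine ⟨Set.eq_singleton_iff_unique_mem.2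
      ⟨⟨hP, Metric.mem_closedBall_self (le_of_lt hε0)⟩, fun x hx => ?_⟩, hε.2⟩
    exact hε.1 x hx.2 (realMap_eq_zero_iff.2 hx.1)

end MixedCurve

theorem mainTheorem5 (f g : MixedCurve.MixedPolynomial) (P : MixedCurve.R4)
    (hf : MixedCurve.IsMixedNonsingular f P) (hg : MixedCurve.IsMixedNonsingular g P)
    (hfg : MixedCurve.IsTransverse f g P) :
    ∃ d : ℤ, MixedCurve.IsTopologicalIntersectionNumber f g P d ∧
      MixedCurve.IsLocalIntersectionNumber f g P d := by
  have h := MixedCurve.det_fderiv_realMap_ne_zero hf.2 hg.2 hfg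
  exact ⟨_, MixedCurve.isTopologicalIntersectionNumber_sign h,
    MixedCurve.isLocalIntersectionNumber_sign ⟨hf.1, hg.1⟩ h⟩
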